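/- All graphs are finite, undirected and without loops. An edge coloring of a graph is an arbitrary assignment of an element of a finite set $\Gamma$ of colors to each edge. A clique in a graph is a complete subgraph induced by a nonempty set of vertices; in a graph with an edge coloring, a clique is regarded as an edge-colored graph under the restriction of the coloring. A Gallai clique is a clique in an edge-colored graph that contains no triangle whose three edges have pairwise different colors; an exact Gallai clique is a Gallai clique in which every triangle has edges of exactly two colors. A monochrome of an edge-colored graph with vertex set $V$ is a connected component, for some color $\alpha \in \Gamma$, of the graph whose vertex set is $V$ and whose edges are the edges of color $\alpha$, considered as an uncolored graph. A full homomorphism from a graph $G$ to a graph $H$ is a map $f$ from the vertices of $G$ to the vertices of $H$ such that, for all vertices $u, v$ of $G$, $uv$ is an edge of $G$ if and only if $f(u)f(v)$ is an edge of $H$. Let $C_5$ be the cycle on five vertices. Let $G$ be a connected (in particular nonempty) graph. Then $G$ is isomorphic to a monochrome of some exact Gallai clique if and only if there is a full homomorphism from $G$ to $C_5$. -/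

import Mathlib

universe u v w

namespace GallaiColoring

open SimpleGraph

/-- The set of colours of the edges of the triangle `x y z`; the colour of an edge is that
given by the edge colouring `col` of `K` (an arbitrary map from the edges of `K` to the set of
colours `Γ`). -/
def triangleColors {W : Type v} {Γ : Type w} {K : SimpleGraph W} (col : K.EdgeLabeling Γ)
    (x y z : W) (hxy : K.Adj x y) (hyz : K.Adj y z) (hzx : K.Adj z x) : Set Γ :=
  {col.get x y hxy, col.get y z hyz, col.get z x hzx}

/-- `a` is (the vertex set of) a clique of `K`: a nonempty set of pairwise adjacent vertices. -/
def IsCliqueSet {W : Type v} (K : SimpleGraph W) (a : Set W) : Prop :=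
  a.Nonempty ∧ K.IsClique a

/-- A Gallai clique in a coloured graph: a clique with no colourful triangle, that is, no triangle
whose three edges have pairwise different colours. -/
def IsGallaiClique {W : Type v} {Γ : Type w} {K : SimpleGraph W} (col : K.EdgeLabeling Γ)
    (a : Set W) : Prop :=
  IsCliqueSet K a ∧
    ∀ x ∈ a, ∀ y ∈ a, ∀ z ∈ a, ∀ (hxy : K.Adj x y) (hyz : K.Adj y z) (hzx : K.Adj z x),
      ¬ (col.get x y hxy ≠ col.get y z hyz ∧ col.get y z hyz ≠ col.get z x hzx ∧
          col.get z x hzx ≠ col.get x y hxy)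

/-- An exact Gallai clique: a Gallai clique in which every triangle has edges of exactly two
colours. -/
def IsExactGallaiClique {W : Type v} {Γ : Type w} {K : SimpleGraph W} (col : K.EdgeLabeling Γ)
    (a : Set W) : Prop :=
  IsGallaiClique col a ∧
    ∀ x ∈ a, ∀ y ∈ a, ∀ z ∈ a, ∀ (hxy : K.Adj x y) (hyz : K.Adj y z) (hzx : K.Adj z x),
      (triangleColors col x y z hxy hyz hzx).ncard = 2

/-- The colouring of the subgraph induced by `a`, by restriction of the colouring of `K`. -/
def restrictColoring {W : Type v} {Γ : Type w} {K : SimpleGraph W} (col : K.EdgeLabeling Γ)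
    (a : Set W) : (K.induce a).EdgeLabeling Γ :=
  col.pullback (SimpleGraph.Embedding.induce a).toHom

/-- `G` is (isomorphic to) a monochrome of the coloured graph `(K, col)`: a connected component of
the graph formed by all the vertices of `K` and the edges of some one colour `α`. -/
def IsMonochromeOf {V : Type u} {W : Type v} {Γ : Type w} (G : SimpleGraph V)
    {K : SimpleGraph W} (col : K.EdgeLabeling Γ) : Prop :=
  ∃ (α : Γ) (c : (col.labelGraph α).ConnectedComponent), Nonempty (G ≃g c.toSimpleGraph)

/-- `G` is (isomorphic to) a monochrome of some exact Gallai clique `a` in some finite graph `K`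
whose edges are coloured by a finite set of colours; the clique is a coloured graph under
the restriction of the colouring. -/
def IsExactGallaiMonochrome {V : Type u} (G : SimpleGraph V) : Prop :=
  ∃ (W : Type v) (_ : Finite W) (Γ : Type w) (_ : Finite Γ) (K : SimpleGraph W)
    (col : K.EdgeLabeling Γ) (a : Set W),
      IsExactGallaiClique col a ∧ IsMonochromeOf G (restrictColoring col a)

/-- A full homomorphism: a map of vertices that preserves both adjacency and non-adjacency. -/
def IsFullHom {V : Type u} {W : Type v} (G : SimpleGraph V) (H : SimpleGraph W)
    (f : V → W) : Prop :=
  ∀ x y : V, G.Adj x y ↔ H.Adj (f x) (f y)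

end GallaiColoring

namespace GallaiColoring

open SimpleGraph

/-! Exactness makes every colour class triangle-free. If the monochrome has no induced four-vertex
path, connectivity makes it complete bipartite or a single vertex, and an edge of the cycle receives
it. Otherwise the Gallai condition gives all three non-edges of an induced path one second colour.
These two colours suffice: triangle-freeness of both and the Gallai condition leave a vertex only
five possible neighbourhoods on the path (`ColorPair.trace`), and these classes are the fibres of
the full homomorphism. Conversely, the five-cycle and its complement are both triangle-free, so two
colours serve between the fibres; ordering the vertices handles the edges inside them. -/

/-- In a connected graph without triangles and without induced four-vertex paths, every vertex is
within distance two of any given non-isolated vertex. -/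
lemma near_of_connected {V : Type u} {G : SimpleGraph V} (hG : G.Connected)
    (tri : ∀ x y z, G.Adj x y → G.Adj y z → ¬ G.Adj x z)
    (hP : ∀ a b c d, G.Adj a b → G.Adj b c → G.Adj c d → ¬ G.Adj a c → ¬ G.Adj b d → G.Adj a d)
    (x z : V) : z = x ∨ G.Adj x z ∨ ∃ y, G.Adj x y ∧ G.Adj y z := by
  have h := (SimpleGraph.reachable_iff_reflTransGen x z).1 (hG.preconnected x z)
  induction h with
  | refl => exact Or.inl rfl
  | @tail z w _ hzw ih =>
    rcases ih with rfl | h | ⟨y, hxy, hyz⟩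
    · exact Or.inr (Or.inl hzw)
    · exact Or.inr (Or.inr ⟨z, h, hzw⟩)
    · exact Or.inr (Or.inl (hP x y z w hxy hyz hzw (tri _ _ _ hxy hyz) (tri _ _ _ hyz hzw)))

/-- A connected triangle-free graph without induced four-vertex paths is complete bipartite (or a
single vertex), and so maps fully to the five-cycle. -/
lemma exists_isFullHom_of_no_path {V : Type u} {G : SimpleGraph V} (hG : G.Connected)
    (tri : ∀ x y z, G.Adj x y → G.Adj y z → ¬ G.Adj x z)
    (hP : ∀ a b c d, G.Adj a b → G.Adj b c → G.Adj c d → ¬ G.Adj a c → ¬ G.Adj b d →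
      G.Adj a d) :
    ∃ f : V → Fin 5, IsFullHom G (cycleGraph 5) f := by
  classical
  obtain ⟨x⟩ := hG.nonempty
  have near := near_of_connected hG tri hP x
  have h01 : (cycleGraph 5).Adj 0 1 := by decide
  have h10 : (cycleGraph 5).Adj 1 0 := by decide
  have join : ∀ y z, G.Adj x y → ¬ G.Adj x z → G.Adj y z := by
    intro y z hy hz
    rcases near z with rfl | h | ⟨t, hxt, htz⟩
    · exact hy.symm
    · exact absurd h hz
    · by_contra hn
      exact hn (hP y x t z hy.symm hxt htz (tri _ _ _ hy.symm hxt) hz)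
  refine ⟨fun y => if G.Adj x y then 1 else 0, fun y z => ?_⟩
  by_cases hy : G.Adj x y <;> by_cases hz : G.Adj x z <;>
    simp only [hy, hz, if_true, if_false, SimpleGraph.irrefl, iff_false, h01, h10, iff_true]
  · exact tri _ _ _ hy.symm hz
  · exact join _ _ hy hz
  · exact (join _ _ hz hy).symm
  · intro hyz
    rcases near y with rfl | h | ⟨t, hxt, hty⟩
    · exact hz hyz
    · exact hy h
    · exact tri _ _ _ (join _ _ hxt hy) hyz (join _ _ hxt hz)

/-- Two edge-disjoint triangle-free graphs, thought of as two colour classes of a Gallai colouring;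
only the consequences for these two colours are kept. -/
structure ColorPair {V : Type u} (G R : SimpleGraph V) : Prop where
  tri : ∀ x y z, G.Adj x y → G.Adj y z → ¬ G.Adj x z
  tri' : ∀ x y z, R.Adj x y → R.Adj y z → ¬ R.Adj x z
  disj : ∀ x y, R.Adj x y → ¬ G.Adj x y
  gallai : ∀ x y z, G.Adj x y → ¬ G.Adj z x → ¬ G.Adj z y → R.Adj z x → R.Adj z y

/-- An induced path on four vertices in the first graph, with its non-edges in the second. -/
structure InducedPath {V : Type u} (G R : SimpleGraph V) (a b c d : V) : Prop where
  ab : G.Adj a b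
  bc : G.Adj b c
  cd : G.Adj c d
  ac : R.Adj a c
  bd : R.Adj b d
  ad : R.Adj a d

/-- Every vertex with a neighbour on an induced four-vertex path has the neighbourhood on the path
of some vertex of the five-cycle through the path. -/
lemma ColorPair.trace {V : Type u} {G R : SimpleGraph V} (h : ColorPair G R) {a b c d : V}
    (p : InducedPath G R a b c d) (v : V)
    (hv : G.Adj v a ∨ G.Adj v b ∨ G.Adj v c ∨ G.Adj v d) :
    (¬ G.Adj v a ∧ G.Adj v b ∧ ¬ G.Adj v c ∧ ¬ G.Adj v d ∧ ¬ R.Adj v a ∧ R.Adj v c ∧ R.Adj v d) ∨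
    (G.Adj v a ∧ ¬ G.Adj v b ∧ G.Adj v c ∧ ¬ G.Adj v d ∧ ¬ R.Adj v b ∧ R.Adj v d) ∨
    (¬ G.Adj v a ∧ G.Adj v b ∧ ¬ G.Adj v c ∧ G.Adj v d ∧ R.Adj v a ∧ ¬ R.Adj v c) ∨
    (¬ G.Adj v a ∧ ¬ G.Adj v b ∧ G.Adj v c ∧ ¬ G.Adj v d ∧ R.Adj v a ∧ R.Adj v b ∧ ¬ R.Adj v d) ∨
    (G.Adj v a ∧ ¬ G.Adj v b ∧ ¬ G.Adj v c ∧ G.Adj v d ∧ R.Adj v b ∧ R.Adj v c) := by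
  have tv := fun x y => h.tri x v y
  have tv' := fun x y => h.tri' x v y
  have gv := fun x z => h.gallai x v z
  have gp := fun x y => h.gallai x y v
  have dv := fun x => h.disj v x
  have da := h.disj _ _ p.ac
  have db := h.disj _ _ p.bd
  have dd := h.disj _ _ p.ad
  obtain ⟨ab, bc, cd, ac, bd, ad⟩ := p
  simp only [G.adj_comm _ v, R.adj_comm _ v] at tv tv' gv
  have t1 := tv a b
  have t2 := tv b c
  have t3 := tv c d
  have r1 := tv' a c
  have r2 := tv' b d
  have r3 := tv' a d
  have g1 := gv a c
  have g2 := gv a d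
  have g3 := gv b d
  have g4 := gv c a
  have g5 := gv d a
  have g6 := gv d b
  have p1 := gp a b ab
  have p2 := gp b a ab.symm
  have p3 := gp b c bc
  have p4 := gp c b bc.symm
  have p5 := gp c d cd
  have p6 := gp d c cd.symm
  have d1 := dv a
  have d2 := dv b
  have d3 := dv c
  have d4 := dv d
  simp only [G.adj_comm c a, G.adj_comm d a, G.adj_comm d b, R.adj_comm c a, R.adj_comm d a,
    R.adj_comm d b] at g1 g2 g3 g4 g5 g6
  clear tv tv' gv gp dv
  by_cases ha : G.Adj v a <;> by_cases hb : G.Adj v b <;> by_cases hc : G.Adj v c <;>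
    by_cases hd : G.Adj v d <;>
    simp only [ha, hb, hc, hd, ab, bc, cd, ac, bd, ad, da, db, dd] at * <;> grind

/-- A vertex with the trace of a path vertex can replace it on the path; tracing a second vertex on
the new path then decides their adjacency. Two vertices of the fifth class share the neighbour `a`,
so they are not adjacent. -/
lemma ColorPair.exists_isFullHom {V : Type u} {G R : SimpleGraph V} (h : ColorPair G R)
    (hG : G.Connected) {a b c d : V} (p : InducedPath G R a b c d) :
    ∃ f : V → Fin 5, IsFullHom G (cycleGraph 5) f := by
  classical
  -- If `w` had no neighbour on the path, an `R`-edge from its neighbour `u` to the path would pass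
  -- to `w` and then spread along the path, making `w`, `a`, `c` an `R`-triangle.
  have dom : ∀ v, G.Adj v a ∨ G.Adj v b ∨ G.Adj v c ∨ G.Adj v d := by
    intro v
    have hr := (SimpleGraph.reachable_iff_reflTransGen a v).1 (hG.preconnected a v)
    induction hr with
    | refl => exact Or.inr (Or.inl p.ab)
    | @tail u w _ huw ih =>
      have tr := h.trace p u ih
      obtain ⟨ab, bc, cd, ac, bd, ad⟩ := p
      obtain ⟨t, t', dj, g⟩ := h
      have := G.adj_comm
      have := R.adj_comm
      have huw : G.Adj u w := huw
      grind
  have pA : ∀ v, G.Adj v b → R.Adj v c → R.Adj v d → InducedPath G R v b c d :=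
    fun v h1 h2 h3 => ⟨h1, p.bc, p.cd, h2, p.bd, h3⟩
  have pB : ∀ v, G.Adj v a → G.Adj v c → R.Adj v d → InducedPath G R a v c d :=
    fun v h1 h2 h3 => ⟨h1.symm, h2, p.cd, p.ac, h3, p.ad⟩
  have pC : ∀ v, G.Adj v b → G.Adj v d → R.Adj v a → InducedPath G R a b v d :=
    fun v h1 h2 h3 => ⟨p.ab, h1.symm, h2, h3.symm, p.bd, p.ad⟩
  have pD : ∀ v, G.Adj v c → R.Adj v a → R.Adj v b → InducedPath G R a b c v :=
    fun v h1 h2 h3 => ⟨p.ab, p.bc, h1.symm, p.ac, h3.symm, h2.symm⟩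
  -- Here `a`, `b`, `c`, `d` go to 0, 1, 2, 3; the value 4 is left for the common neighbours of `a`
  -- and `d`.
  refine ⟨fun v => if G.Adj v b then (if G.Adj v d then 2 else 0) else
    if G.Adj v c then (if G.Adj v a then 1 else 3) else 4, fun v w => ?_⟩
  have hvw := G.adj_comm w v
  have tA := fun h1 h2 h3 => h.trace (pA v h1 h2 h3) w
  have tB := fun h1 h2 h3 => h.trace (pB v h1 h2 h3) w
  have tC := fun h1 h2 h3 => h.trace (pC v h1 h2 h3) w
  have tD := fun h1 h2 h3 => h.trace (pD v h1 h2 h3) w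
  have sA := fun h1 h2 h3 => h.trace (pA w h1 h2 h3) v
  have sB := fun h1 h2 h3 => h.trace (pB w h1 h2 h3) v
  have sC := fun h1 h2 h3 => h.trace (pC w h1 h2 h3) v
  have sD := fun h1 h2 h3 => h.trace (pD w h1 h2 h3) v
  have ta := h.tri v w a
  have td := h.tri v w d
  have C : ∀ i j : Fin 5, (cycleGraph 5).Adj i j ↔ (i = j + 1 ∨ j = i + 1) := by decide
  have tv := h.trace p v (dom v)
  have tw := h.trace p w (dom w)
  clear pA pB pC pD dom p h hG
  rw [C]
  rcases tv with tv | tv | tv | tv | tv <;> rcases tw with tw | tw | tw | tw | tw <;>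
    simp only [tv, tw, if_true, if_false] <;>
    simp only [Fin.reduceAdd, Fin.reduceEq, or_true, or_false, iff_true, iff_false] <;>
    grind

/-- The edges of colour `γ` between vertices placed in the set `s` of a coloured graph. -/
def colorClass {V : Type u} {W : Type v} {Γ : Type w} {K : SimpleGraph W} (col : K.EdgeLabeling Γ)
    {s : Set W} (e : V ↪ s) (γ : Γ) : SimpleGraph V :=
  ((restrictColoring col s).labelGraph γ).comap e

lemma colorClass_adj {V : Type u} {W : Type v} {Γ : Type w} {K : SimpleGraph W}
    (col : K.EdgeLabeling Γ) {s : Set W} (e : V ↪ s) (γ : Γ) (x y : V) :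
    (colorClass col e γ).Adj x y ↔ ∃ h : K.Adj (e x) (e y), col.get (e x) (e y) h = γ :=
  EdgeLabeling.labelGraph_adj _ _

lemma colorClass_not_triangle {V : Type u} {W : Type v} {Γ : Type w} {K : SimpleGraph W}
    {col : K.EdgeLabeling Γ} {s : Set W} (hs : IsExactGallaiClique col s) (e : V ↪ s) (γ : Γ)
    (x y z : V) (hxy : (colorClass col e γ).Adj x y) (hyz : (colorClass col e γ).Adj y z) :
    ¬ (colorClass col e γ).Adj x z := by
  intro hxz
  obtain ⟨k1, h1⟩ := (colorClass_adj _ _ _ _ _).1 hxy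
  obtain ⟨k2, h2⟩ := (colorClass_adj _ _ _ _ _).1 hyz
  obtain ⟨k3, h3⟩ := (colorClass_adj _ _ _ _ _).1 hxz.symm
  have := hs.2 _ (e x).2 _ (e y).2 _ (e z).2 k1 k2 k3
  simp [triangleColors, h1, h2, h3] at this

/-- Two colour classes of an exact Gallai clique form a colour pair. -/
lemma colorPair_of_isExactGallaiClique {V : Type u} {W : Type v} {Γ : Type w} {K : SimpleGraph W}
    {col : K.EdgeLabeling Γ} {s : Set W} (hs : IsExactGallaiClique col s) {α β : Γ} (hαβ : α ≠ β)
    (e : V ↪ s) :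
    ColorPair (colorClass col e α) (colorClass col e β) := by
  have adj := colorClass_adj col e
  have mono := colorClass_not_triangle hs e
  obtain ⟨⟨⟨-, hK⟩, hg⟩, -⟩ := hs
  refine ⟨mono α, mono β, ?_, ?_⟩
  · intro x y h1 h2
    obtain ⟨k1, h1⟩ := (adj _ _ _).1 h1
    obtain ⟨k2, h2⟩ := (adj _ _ _).1 h2
    exact hαβ (h2.symm.trans h1)
  · intro x y z h1 h2 h3 h4
    have hne : (e z : W) ≠ e y := by
      intro h
      have : z = y := e.injective (Subtype.ext h)
      exact h2 (this ▸ h1.symm)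
    obtain ⟨k1, h1⟩ := (adj _ _ _).1 h1
    obtain ⟨k4, h4⟩ := (adj _ _ _).1 h4
    have k3 := hK (e z).2 (e y).2 hne
    refine (adj _ _ _).2 ⟨k3, ?_⟩
    have h3' : col.get _ _ k3 ≠ α := fun h => h3 ((adj _ _ _).2 ⟨k3, h⟩)
    have := hg _ (e z).2 _ (e x).2 _ (e y).2 k4 k1 k3.symm
    rw [EdgeLabeling.get_comm _ _ k3.symm, h1, h4] at this
    by_contra hn
    exact this ⟨hαβ.symm, h3'.symm, hn⟩

lemma exists_isFullHom_of_isExactGallaiMonochrome {V : Type u} {G : SimpleGraph V}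
    (hG : G.Connected) (h : IsExactGallaiMonochrome.{u, v, w} G) :
    ∃ f : V → Fin 5, IsFullHom G (cycleGraph 5) f := by
  obtain ⟨W, _, Γ, _, K, col, s, hs, α, c, ⟨φ⟩⟩ := h
  let e : V ↪ s := φ.toEquiv.toEmbedding.trans (Function.Embedding.subtype _)
  have hGe : G = colorClass col e α := by
    ext x y
    exact φ.map_rel_iff.symm
  have ex : ∀ x y, x ≠ y → ∃ β, (colorClass col e β).Adj x y := by
    intro x y hxy
    have hne : (e x : W) ≠ e y := fun h => hxy (e.injective (Subtype.ext h))
    exact ⟨_, (EdgeLabeling.labelGraph_adj _ _).2 ⟨hs.1.1.2 (e x).2 (e y).2 hne, rfl⟩⟩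
  have mono := colorClass_not_triangle hs e α
  rw [← hGe] at mono
  by_cases hP : ∀ a b c d, G.Adj a b → G.Adj b c → G.Adj c d → ¬ G.Adj a c → ¬ G.Adj b d →
      G.Adj a d
  · exact exists_isFullHom_of_no_path hG mono hP
  · push Not at hP
    obtain ⟨a, b, c, d, ab, bc, cd, ac, bd, ad⟩ := hP
    have hac : a ≠ c := by rintro rfl; exact ad cd
    obtain ⟨β, hβ⟩ := ex a c hac
    have hαβ : α ≠ β := by
      rintro rfl
      exact ac (hGe ▸ hβ)
    have hp := colorPair_of_isExactGallaiClique hs hαβ e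
    rw [← hGe] at hp
    -- The second colour passes from `ac` to `ad` across the edge `cd`, then to `bd` across `ab`.
    have had := hp.gallai c d a cd ac ad hβ
    have hbd := hp.gallai a b d ab (fun h => ad h.symm) (fun h => bd h.symm) had.symm
    exact hp.exists_isFullHom hG ⟨ab, bc, cd, hβ, hbd.symm, had⟩

/-- A blow-up of the five-cycle as a colour class: edges get one colour, non-edges between
different fibres another, and within the fibres an edge is coloured by its larger end. -/
lemma isExactGallaiMonochrome_of_isFullHom {V : Type u} [Finite V] {G : SimpleGraph V}
    (hG : G.Connected) {f : V → Fin 5} (hf : IsFullHom G (cycleGraph 5) f) :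
    IsExactGallaiMonochrome.{u, v, w} G := by
  classical
  obtain ⟨n, ⟨eV⟩⟩ := Finite.exists_equiv_fin V
  let g : ULift.{v} (Fin n) → V := fun x => eV.symm x.down
  let Γ := ULift.{w} (Option (Option (Fin n)))
  let q : ULift.{v} (Fin n) → ULift.{v} (Fin n) → Γ := fun x y =>
    ⟨if G.Adj (g x) (g y) then none else if f (g x) = f (g y) then some (some (max x.down y.down))
      else some none⟩
  have hq : ∀ x y, q y x = q x y := by
    intro x y
    simp only [q, G.adj_comm (g y), eq_comm (a := f (g y)), max_comm y.down]
  let col : (⊤ : SimpleGraph (ULift.{v} (Fin n))).EdgeLabeling Γ :=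
    EdgeLabeling.mk (fun x y _ => q x y) (fun x y _ => hq x y)
  have hget : ∀ x y h, col.get x y h = q x y := fun x y h => EdgeLabeling.get_mk _ _ _ _ _
  have two : ∀ x y z : ULift.{v} (Fin n), x ≠ y → y ≠ z → z ≠ x →
      (q x y = q y z ∧ q y z ≠ q z x) ∨ (q y z = q z x ∧ q z x ≠ q x y) ∨
        (q z x = q x y ∧ q x y ≠ q y z) := by
    rintro ⟨x⟩ ⟨y⟩ ⟨z⟩ hxy hyz hzx
    -- Three distinct fibres span neither a triangle nor an independent triple of the cycle.
    have hC : ∀ i j k : Fin 5, i ≠ j → j ≠ k → k ≠ i →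
        ¬ ((cycleGraph 5).Adj i j ∧ (cycleGraph 5).Adj j k ∧ (cycleGraph 5).Adj k i) ∧
        ((cycleGraph 5).Adj i j ∨ (cycleGraph 5).Adj j k ∨ (cycleGraph 5).Adj k i) := by decide
    have hC := hC (f (g ⟨x⟩)) (f (g ⟨y⟩)) (f (g ⟨z⟩))
    have hI : ∀ i, ¬ (cycleGraph 5).Adj i i := fun i => SimpleGraph.irrefl _
    have hS := (cycleGraph 5).adj_comm
    simp only [ne_eq, ULift.up_inj] at hxy hyz hzx
    -- The two edges at the largest vertex agree, and the third has a smaller maximum.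
    have hm : max x y = max y z ∧ max y z ≠ max z x ∨ max y z = max z x ∧ max z x ≠ max x y ∨
        max z x = max x y ∧ max x y ≠ max y z := by grind
    simp only [q, hf _ _, ne_eq]
    grind
  have hclique : IsExactGallaiClique col Set.univ := by
    refine ⟨⟨⟨⟨⟨eV hG.nonempty.some⟩, trivial⟩, fun x _ y _ h => h⟩, ?_⟩, ?_⟩
    · intro x _ y _ z _ hxy hyz hzx
      rw [hget, hget, hget]
      have := two x y z hxy hyz hzx
      tauto
    · intro x _ y _ z _ hxy hyz hzx
      rw [triangleColors, hget, hget, hget]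
      rcases two x y z hxy hyz hzx with ⟨h, h'⟩ | ⟨h, h'⟩ | ⟨h, h'⟩
      · rw [h, Set.insert_eq_of_mem (by simp), Set.ncard_pair h']
      · rw [h, Set.pair_eq_singleton, Set.ncard_pair h'.symm]
      · rw [h, Set.pair_comm, Set.insert_eq_of_mem (by simp), Set.ncard_pair h']
  let H := (restrictColoring col Set.univ).labelGraph (⟨none⟩ : Γ)
  have hH : ∀ x y, H.Adj x y ↔ G.Adj (g x) (g y) := by
    intro x y
    refine (EdgeLabeling.labelGraph_adj _ _).trans ⟨fun ⟨h, hc⟩ => ?_, fun h => ⟨?_, ?_⟩⟩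
    · have hc : q x y = ⟨none⟩ := hc
      by_contra hn
      simp only [q, hn, if_false] at hc
      have hc := congrArg ULift.down hc
      split_ifs at hc
    · intro hxy
      exact h.ne (congrArg g hxy)
    · change q x y = ⟨none⟩
      simp only [q, h, if_true]
  let ψ : G ≃g H :=
    { toFun := fun x => ⟨⟨eV x⟩, trivial⟩
      invFun := fun x => g x
      left_inv := fun x => by simp [g]
      right_inv := fun x => by simp [g]
      map_rel_iff' := by
        intro x y
        refine (hH _ _).trans ?_
        simp [g] }
  have hHc : H.Connected := ψ.connected_iff.1 hG
  let c := H.connectedComponentMk (ψ hG.nonempty.some)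
  have hc : ∀ x, x ∈ c.supp := fun x => ConnectedComponent.sound (hHc.preconnected _ _)
  let χ : H ≃g c.toSimpleGraph :=
    { toFun := fun x => ⟨x, hc x⟩
      invFun := fun x => x.1
      left_inv := fun x => rfl
      right_inv := fun x => rfl
      map_rel_iff' := Iff.rfl }
  exact ⟨_, inferInstance, Γ, inferInstance, _, col, Set.univ, hclique, ⟨none⟩, c, ⟨ψ.trans χ⟩⟩

end GallaiColoring

theorem mainTheorem7 {V : Type u} [Finite V] (G : SimpleGraph V) (hG : G.Connected) :
    GallaiColoring.IsExactGallaiMonochrome.{u, v, w} G ↔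
      ∃ f : V → Fin 5, GallaiColoring.IsFullHom G (SimpleGraph.cycleGraph 5) f :=
  ⟨GallaiColoring.exists_isFullHom_of_isExactGallaiMonochrome hG,
    fun ⟨_, hf⟩ => GallaiColoring.isExactGallaiMonochrome_of_isFullHom hG hf⟩
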